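/- Let $d \ge 1$, let $\diamond^d = \operatorname{conv}\{\pm e_1, \dots, \pm e_d\} \subset \mathbb{R}^d$ be the standard cross-polytope, and let $\ell = \sum_{i=1}^d e_i^{T}$, i.e. $\ell(v) = v_1 + \dots + v_d$. For a polytope $P \subset \mathbb{R}^d$ and a linear functional $\varphi$ on $\mathbb{R}^d$, the monotone path polytope is \[ MPP_\varphi(P) = \operatorname{conv}\Bigl\{ \int_{\varphi(P)} s(x)\,dx \;:\; s \colon \varphi(P) \to P \text{ continuous with } \varphi(s(x)) = x \text{ for all } x \in \varphi(P) \Bigr\}. \] Let $\Delta_{d-1} = \operatorname{conv}\{e_1, \dots, e_d\} \subset \mathbb{R}^d$ be the standard simplex. Then \[ MPP_\ell(\diamond^d) = \Delta_{d-1} - \Delta_{d-1} = \{a - b : a, b \in \Delta_{d-1}\}. \] -/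

import Mathlib

open MeasureTheory
open scoped Pointwise

/-- A section of `ℓ : P → ℓ(P)`: a continuous map `s` defined on `ℓ(P)`, with values in `P`,
such that `ℓ (s x) = x` for every `x ∈ ℓ(P)`. Values of `s` outside `ℓ(P)` are irrelevant. -/
structure IsPolytopeSection {E : Type*} [NormedAddCommGroup E] [NormedSpace ℝ E]
    (ℓ : E →ₗ[ℝ] ℝ) (P : Set E) (s : ℝ → E) : Prop where
  continuousOn : ContinuousOn s (ℓ '' P)
  mapsTo : Set.MapsTo s (ℓ '' P) P
  rightInvOn : ∀ x ∈ ℓ '' P, ℓ (s x) = x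

/-- The monotone path polytope `conv {∫_{ℓ(P)} s(x) dx : s a section of ℓ}` of `P` with respect
to the linear functional `ℓ`. -/
noncomputable def monotonePathPolytope {E : Type*} [NormedAddCommGroup E] [NormedSpace ℝ E]
    (ℓ : E →ₗ[ℝ] ℝ) (P : Set E) : Set E :=
  convexHull ℝ {y | ∃ s : ℝ → E, IsPolytopeSection ℓ P s ∧ y = ∫ x in ℓ '' P, s x}

/-- The standard cross-polytope in `ℝ^d`: the convex hull of `± e_1, …, ± e_d`. -/
def crossPolytope (d : ℕ) : Set (Fin d → ℝ) :=
  convexHull ℝ {v | ∃ i : Fin d, v = Pi.single i 1 ∨ v = -Pi.single i 1}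

/-- The linear functional `∑ i, e_iᵀ` on `ℝ^d`, that is `v ↦ v_1 + ⋯ + v_d`. -/
def sumFunctional (d : ℕ) : (Fin d → ℝ) →ₗ[ℝ] ℝ :=
  ∑ i : Fin d, LinearMap.proj i

/-! Here `ℓ(P) = [-1, 1]`. For a section `s`, integrating `∑ s_i(x) = x` gives coordinate sum 0, and
integrating `∑ |s_i(x)| ≤ 1` gives ℓ¹-norm at most 2; these two conditions force membership in `Δ -
Δ` (`mem_stdSimplex_sub_stdSimplex`). Conversely, `a - b` is the integral of the straight section
from `-b` to `a` (`integral_segment`). -/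

theorem sumFunctional_apply {d : ℕ} (v : Fin d → ℝ) : sumFunctional d v = ∑ i, v i := by
  simp [sumFunctional]

theorem sum_abs_le_one_of_mem_crossPolytope {d : ℕ} {v : Fin d → ℝ} (hv : v ∈ crossPolytope d) :
    ∑ i, |v i| ≤ 1 := by
  have hconv : Convex ℝ {v : Fin d → ℝ | ∑ i, |v i| ≤ 1} := by
    have h : ConvexOn ℝ Set.univ fun v : Fin d → ℝ => ∑ i, |v i| := by
      refine ⟨convex_univ, fun x _ y _ a b ha hb _ => ?_⟩
      simp only [smul_eq_mul, Finset.mul_sum, ← Finset.sum_add_distrib]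
      refine Finset.sum_le_sum fun i _ => (abs_add_le _ _).trans_eq ?_
      simp [abs_mul, abs_of_nonneg ha, abs_of_nonneg hb]
    simpa using h.convex_le 1
  refine convexHull_min ?_ hconv hv
  rintro w ⟨i, rfl | rfl⟩ <;> simp [Pi.single_apply, apply_ite abs]

theorem stdSimplex_subset_crossPolytope (d : ℕ) : stdSimplex ℝ (Fin d) ⊆ crossPolytope d := by
  rw [← convexHull_basis_eq_stdSimplex]
  refine convexHull_mono ?_
  rintro _ ⟨i, rfl⟩
  refine ⟨i, Or.inl ?_⟩
  ext j
  simp [Pi.single_apply, eq_comm]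

theorem neg_mem_crossPolytope {d : ℕ} {v : Fin d → ℝ} (hv : v ∈ crossPolytope d) :
    -v ∈ crossPolytope d := by
  rw [crossPolytope, ← Set.mem_neg, ← convexHull_neg]
  refine convexHull_mono ?_ hv
  rintro w ⟨i, rfl | rfl⟩
  · exact ⟨i, Or.inr rfl⟩
  · exact ⟨i, Or.inl (neg_neg _)⟩

theorem segment_point_mem_crossPolytope {d : ℕ} {a b : Fin d → ℝ}
    (ha : a ∈ stdSimplex ℝ (Fin d)) (hb : b ∈ stdSimplex ℝ (Fin d)) {x : ℝ}
    (hx : x ∈ Set.Icc (-1 : ℝ) 1) :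
    ((1 + x) / 2) • a - ((1 - x) / 2) • b ∈ crossPolytope d := by
  rw [sub_eq_add_neg, ← smul_neg]
  exact convex_convexHull ℝ _ (stdSimplex_subset_crossPolytope d ha)
    (neg_mem_crossPolytope (stdSimplex_subset_crossPolytope d hb))
    (by linarith [hx.1]) (by linarith [hx.2]) (by ring)

theorem sumFunctional_segment_point {d : ℕ} {a b : Fin d → ℝ}
    (ha : a ∈ stdSimplex ℝ (Fin d)) (hb : b ∈ stdSimplex ℝ (Fin d)) (x : ℝ) :
    sumFunctional d (((1 + x) / 2) • a - ((1 - x) / 2) • b) = x := by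
  rw [map_sub, map_smul, map_smul, sumFunctional_apply, sumFunctional_apply, ha.2, hb.2,
    smul_eq_mul, smul_eq_mul]
  ring

theorem sumFunctional_image_crossPolytope {d : ℕ} (hd : 1 ≤ d) :
    sumFunctional d '' crossPolytope d = Set.Icc (-1) 1 := by
  refine Set.Subset.antisymm ?_ fun x hx => ?_
  · rintro _ ⟨v, hv, rfl⟩
    rw [sumFunctional_apply, Set.mem_Icc, ← abs_le]
    exact (Finset.abs_sum_le_sum_abs _ _).trans (sum_abs_le_one_of_mem_crossPolytope hv)
  -- The segment from `-e` to `e`, for one vertex `e`, already attains every value; `hd` supplies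
  -- the vertex.
  · have h := single_mem_stdSimplex ℝ (⟨0, hd⟩ : Fin d)
    exact ⟨_, segment_point_mem_crossPolytope h h hx, sumFunctional_segment_point h h x⟩

/-- Since `y` has sum 0, its positive and negative parts have equal mass `t ≤ 1`. Adding the missing
mass `1 - t` to both at the same vertex makes them simplex points and leaves their difference
unchanged. -/
theorem mem_stdSimplex_sub_stdSimplex {d : ℕ} (hd : 1 ≤ d) {y : Fin d → ℝ}
    (hsum : ∑ i, y i = 0) (habs : ∑ i, |y i| ≤ 2) :
    y ∈ stdSimplex ℝ (Fin d) - stdSimplex ℝ (Fin d) := by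
  set t : ℝ := (∑ i, |y i|) / 2 with ht
  let e : Fin d → ℝ := Pi.single ⟨0, hd⟩ 1
  have he : e ∈ stdSimplex ℝ (Fin d) := single_mem_stdSimplex ℝ _
  have ht1 : 0 ≤ 1 - t := by linarith
  refine ⟨fun i => (|y i| + y i) / 2 + (1 - t) * e i, ⟨fun i => ?_, ?_⟩,
    fun i => (|y i| - y i) / 2 + (1 - t) * e i, ⟨fun i => ?_, ?_⟩, ?_⟩
  · exact add_nonneg (by linarith [neg_abs_le (y i)]) (mul_nonneg ht1 (he.1 i))
  · rw [Finset.sum_add_distrib, ← Finset.mul_sum, he.2, ← Finset.sum_div,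
      Finset.sum_add_distrib, hsum]
    linarith
  · exact add_nonneg (by linarith [le_abs_self (y i)]) (mul_nonneg ht1 (he.1 i))
  · rw [Finset.sum_add_distrib, ← Finset.mul_sum, he.2, ← Finset.sum_div,
      Finset.sum_sub_distrib, hsum]
    linarith
  · ext i
    simp only [Pi.sub_apply]
    ring

theorem integral_Icc_neg_one_one_id : ∫ x in Set.Icc (-1 : ℝ) 1, x = 0 := by
  rw [integral_Icc_eq_integral_Ioc, ← intervalIntegral.integral_of_le (by norm_num), integral_id]
  norm_num

theorem integral_segment {d : ℕ} (a b : Fin d → ℝ) :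
    ∫ x in Set.Icc (-1 : ℝ) 1, (((1 + x) / 2) • a - ((1 - x) / 2) • b) = a - b := by
  have hid : IntegrableOn (fun x : ℝ => x) (Set.Icc (-1) 1) :=
    continuous_id.continuousOn.integrableOn_Icc
  have hconst : IntegrableOn (fun _ : ℝ => (2⁻¹ : ℝ) • (a - b)) (Set.Icc (-1) 1) :=
    continuous_const.continuousOn.integrableOn_Icc
  -- Constant plus odd part: the odd part integrates to 0, and the length 2 of the interval cancels
  -- `2⁻¹`.
  have hfun : ∀ x : ℝ, ((1 + x) / 2) • a - ((1 - x) / 2) • b =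
      (2⁻¹ : ℝ) • (a - b) + x • ((2⁻¹ : ℝ) • (a + b)) := fun x => by module
  simp_rw [hfun]
  rw [integral_add hconst (hid.smul_const _), setIntegral_const, integral_smul_const,
    integral_Icc_neg_one_one_id, Real.volume_real_Icc_of_le (by norm_num)]
  module

theorem integral_section_mem {d : ℕ} (hd : 1 ≤ d) {s : ℝ → Fin d → ℝ}
    (hs : IsPolytopeSection (sumFunctional d) (crossPolytope d) s) :
    ∫ x in Set.Icc (-1 : ℝ) 1, s x ∈ stdSimplex ℝ (Fin d) - stdSimplex ℝ (Fin d) := by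
  obtain ⟨hcont, hmaps, hinv⟩ := hs
  rw [sumFunctional_image_crossPolytope hd] at hcont hmaps hinv
  have hint : ∀ i, IntegrableOn (fun x => s x i) (Set.Icc (-1) 1) := fun i =>
    ((continuous_apply i).comp_continuousOn hcont).integrableOn_Icc
  have heval : ∀ i, (∫ x in Set.Icc (-1 : ℝ) 1, s x) i = ∫ x in Set.Icc (-1 : ℝ) 1, s x i :=
    fun i => eval_integral hint i
  refine mem_stdSimplex_sub_stdSimplex hd ?_ ?_
  · simp_rw [heval]
    rw [← integral_finsetSum _ fun i _ => hint i, ← integral_Icc_neg_one_one_id]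
    refine setIntegral_congr_fun measurableSet_Icc fun x hx => ?_
    exact (sumFunctional_apply _).symm.trans (hinv x hx)
  · simp_rw [heval]
    calc ∑ i, |∫ x in Set.Icc (-1 : ℝ) 1, s x i|
        ≤ ∑ i, ∫ x in Set.Icc (-1 : ℝ) 1, |s x i| :=
          Finset.sum_le_sum fun i _ => abs_integral_le_integral_abs
      _ = ∫ x in Set.Icc (-1 : ℝ) 1, ∑ i, |s x i| :=
          (integral_finsetSum _ fun i _ => (hint i).abs).symm
      _ ≤ ∫ _ in Set.Icc (-1 : ℝ) 1, (1 : ℝ) :=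
          setIntegral_mono_on (integrable_finsetSum _ fun i _ => (hint i).abs)
            continuous_const.continuousOn.integrableOn_Icc measurableSet_Icc
            fun x hx => sum_abs_le_one_of_mem_crossPolytope (hmaps hx)
      _ = 2 := by
          rw [setIntegral_const, Real.volume_real_Icc_of_le (by norm_num)]
          norm_num

theorem mainTheorem6 (d : ℕ) (hd : 1 ≤ d) :
    monotonePathPolytope (sumFunctional d) (crossPolytope d) =
      stdSimplex ℝ (Fin d) - stdSimplex ℝ (Fin d) := by
  rw [monotonePathPolytope, sumFunctional_image_crossPolytope hd]
  refine Set.Subset.antisymm (convexHull_min ?_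
    ((convex_stdSimplex ℝ _).sub (convex_stdSimplex ℝ _))) ?_
  · rintro _ ⟨s, hs, rfl⟩
    exact integral_section_mem hd hs
  · rintro _ ⟨a, ha, b, hb, rfl⟩
    refine subset_convexHull ℝ _
      ⟨fun x => ((1 + x) / 2) • a - ((1 - x) / 2) • b, ⟨?_, ?_, ?_⟩, (integral_segment a b).symm⟩
    · fun_prop
    · rw [sumFunctional_image_crossPolytope hd]
      exact fun x hx => segment_point_mem_crossPolytope ha hb hx
    · exact fun x _ => sumFunctional_segment_point ha hb x
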